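/- Let $d\ge 1$, $0<\alpha<2$, $m\ge 0$ and $v>0$. Let $L_{m,\alpha}=(-\Delta+m^{2/\alpha})^{\alpha/2}-m$ be the operator in $L^2(\mathbb R^d)$ that acts in Fourier space as multiplication by $(|y|^2+m^{2/\alpha})^{\alpha/2}-m$, with domain the set of all $f\in L^2(\mathbb R^d)$ for which this multiple of $\widehat f$ is again in $L^2(\mathbb R^d)$. Let $\mathcal K\subset\mathbb R^d$ be a bounded Lebesgue measurable set with non-empty interior, and let $H_{m,\alpha}=L_{m,\alpha}-v\mathbf 1_{\mathcal K}$ on the domain of $L_{m,\alpha}$. A ground state of $H_{m,\alpha}$ is a non-zero $\varphi_0$ in this domain with $H_{m,\alpha}\varphi_0=\lambda_0\varphi_0$, where $\lambda_0=\inf\operatorname{Spec}H_{m,\alpha}$. Let $\mathcal H\subset\mathbb R^d$ be a hyperplane with $0\in\mathcal H$, let $\mathsf S:\mathbb R^d\to\mathbb R^d$ be the reflection with respect to $\mathcal H$, and suppose that $\mathsf S\mathcal K=\mathcal K$. If $\varphi_0$ is a ground state of $H_{m,\alpha}$, then $\varphi_0(\mathsf Sx)=\varphi_0(x)$ for almost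 every $x\in\mathbb R^d$; and if $\varphi_0$ is represented by a continuous function, then $\varphi_0(\mathsf Sx)=\varphi_0(x)$ for all $x\in\mathbb R^d$. -/

import Mathlib

open MeasureTheory FourierTransform

noncomputable section

namespace RelSchrodinger

/-- The Hilbert space `L²(ℝᵈ; ℂ)`. -/
abbrev L2 (d : ℕ) : Type := Lp (α := EuclideanSpace ℝ (Fin d)) ℂ 2 volume

/-- The domain `{f ∈ L² : w f ∈ L²}` of the maximal operator of multiplication by `w`. -/
def mulDomain {d : ℕ} (w : EuclideanSpace ℝ (Fin d) → ℂ) : Submodule ℂ (L2 d) where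
  carrier := {f | MemLp (fun x => w x * f x) 2 volume}
  add_mem' := by
    intro f g hf hg
    refine MemLp.ae_eq ?_ (MemLp.add hf hg)
    filter_upwards [Lp.coeFn_add f g] with x hx
    rw [hx, Pi.add_apply, Pi.add_apply, mul_add]
  zero_mem' := by
    refine MemLp.ae_eq ?_ (MemLp.zero (ε := ℂ))
    filter_upwards [Lp.coeFn_zero ℂ 2 (volume : Measure (EuclideanSpace ℝ (Fin d)))] with x hx
    rw [hx, Pi.zero_apply, mul_zero]
  smul_mem' := by
    intro c f hf
    refine MemLp.ae_eq ?_ (MemLp.const_smul hf c)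
    filter_upwards [Lp.coeFn_smul c f] with x hx
    rw [hx, Pi.smul_apply, Pi.smul_apply, smul_eq_mul, smul_eq_mul, mul_left_comm]

/-- The maximal operator of multiplication by the function `w` in `L²(ℝᵈ; ℂ)`. -/
def mulOp {d : ℕ} (w : EuclideanSpace ℝ (Fin d) → ℂ) : L2 d →ₗ.[ℂ] L2 d where
  domain := mulDomain w
  toFun :=
    { toFun := fun f => MemLp.toLp (fun x => w x * (f : L2 d) x) f.2
      map_add' := by
        intro f g
        have hf : MemLp (fun x => w x * (f : L2 d) x) 2 volume := f.2
        have hg : MemLp (fun x => w x * (g : L2 d) x) 2 volume := g.2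
        refine Eq.trans ?_ (MemLp.toLp_add hf hg)
        refine MemLp.toLp_congr _ _ ?_
        filter_upwards [Lp.coeFn_add (f : L2 d) (g : L2 d)] with x hx
        rw [Submodule.coe_add, hx, Pi.add_apply, Pi.add_apply, mul_add]
      map_smul' := by
        intro c f
        have hf : MemLp (fun x => w x * (f : L2 d) x) 2 volume := f.2
        refine Eq.trans ?_ (MemLp.toLp_const_smul c hf)
        refine MemLp.toLp_congr _ _ ?_
        filter_upwards [Lp.coeFn_smul c (f : L2 d)] with x hx
        rw [Submodule.coe_smul, hx, Pi.smul_apply, Pi.smul_apply, smul_eq_mul, smul_eq_mul,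
          mul_left_comm] }

/-- The Fourier multiplier with symbol `w`, that is `𝓕⁻¹ (w · 𝓕 f)`, with domain
`{f ∈ L² : w · 𝓕 f ∈ L²}`. The Fourier transform is Mathlib's unitary one on `L²`,
`𝓕 f ξ = ∫ exp (-2πi ⟨x, ξ⟩) f x dx`. -/
def fourierMultiplier {d : ℕ} (w : EuclideanSpace ℝ (Fin d) → ℂ) : L2 d →ₗ.[ℂ] L2 d where
  domain := (mulDomain w).comap
    (Lp.fourierTransformₗᵢ (EuclideanSpace ℝ (Fin d)) ℂ).toLinearEquiv.toLinearMap
  toFun :=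
    { toFun := fun f => 𝓕⁻ ((mulOp w) ⟨𝓕 (f : L2 d), f.2⟩)
      map_add' := by
        intro f g
        have h : (⟨𝓕 ((f + g : _) : L2 d), (f + g).2⟩ : (mulOp w).domain)
            = ⟨𝓕 (f : L2 d), f.2⟩ + ⟨𝓕 (g : L2 d), g.2⟩ :=
          Subtype.ext (FourierTransform.fourier_add _ _)
        rw [h, LinearPMap.map_add, FourierTransform.fourierInv_add]
      map_smul' := by
        intro c f
        have h : (⟨𝓕 ((c • f : _) : L2 d), (c • f).2⟩ : (mulOp w).domain)
            = c • ⟨𝓕 (f : L2 d), f.2⟩ :=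
          Subtype.ext (FourierTransform.fourier_smul _ _)
        rw [h, LinearPMap.map_smul, FourierTransform.fourierInv_smul, RingHom.id_apply] }

/-- `Φ_{m,α}(z) = (z + m^{2/α})^{α/2} - m`. -/
def Phi (m α z : ℝ) : ℝ := (z + m ^ (2 / α)) ^ (α / 2) - m

/-- The massive (`m > 0`) or massless (`m = 0`) relativistic operator
`L_{m,α} = Φ_{m,α}(-Δ) = (-Δ + m^{2/α})^{α/2} - m`. With Mathlib's normalisation of the Fourier
transform, `-Δ` has the symbol `|2πξ|²`. -/
def relOp (d : ℕ) (m α : ℝ) : L2 d →ₗ.[ℂ] L2 d :=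
  fourierMultiplier fun ξ => ((Phi m α ((2 * Real.pi * ‖ξ‖) ^ 2) : ℝ) : ℂ)

open Classical in
/-- The potential well `V = -v 1_K`. -/
def well {d : ℕ} (v : ℝ) (K : Set (EuclideanSpace ℝ (Fin d))) :
    EuclideanSpace ℝ (Fin d) → ℂ :=
  fun x => if x ∈ K then -(v : ℂ) else 0

/-- The relativistic Schrödinger operator `H_{m,α} = L_{m,α} - v 1_K`, defined on the intersection
of the domains of the two summands (which is the domain of `L_{m,α}`, as `1_K` is bounded). -/
def schrodingerOp {d : ℕ} (m α v : ℝ) (K : Set (EuclideanSpace ℝ (Fin d))) :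
    L2 d →ₗ.[ℂ] L2 d :=
  relOp d m α + mulOp (well v K)

/-- The resolvent set of a (possibly unbounded) operator `T` in a normed space: those `z` for which
`T - z` maps the domain of `T` bijectively onto the space, with an everywhere defined bounded
inverse `R`. -/
def resolventSet {X : Type*} [NormedAddCommGroup X] [NormedSpace ℂ X] (T : X →ₗ.[ℂ] X) : Set ℂ :=
  {z | ∃ R : X →L[ℂ] X,
    (∀ g : X, ∃ h : R g ∈ T.domain, T ⟨R g, h⟩ - z • R g = g) ∧
    (∀ f : T.domain, R (T f - z • (f : X)) = f)}

/-- The spectrum of a (possibly unbounded) operator. -/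
def spec {X : Type*} [NormedAddCommGroup X] [NormedSpace ℂ X] (T : X →ₗ.[ℂ] X) : Set ℂ :=
  (resolventSet T)ᶜ

/-- `f` is a ground state of `T`: a non-zero element of the domain with `T f = λ₀ f`, where
`λ₀` is the infimum of the (real) spectrum of `T`. -/
def IsGroundState {X : Type*} [NormedAddCommGroup X] [NormedSpace ℂ X] (T : X →ₗ.[ℂ] X)
    (f : X) : Prop :=
  f ≠ 0 ∧ ∃ l : ℝ, IsGLB {r : ℝ | (r : ℂ) ∈ spec T} l ∧
    ∃ h : f ∈ T.domain, T ⟨f, h⟩ = (l : ℂ) • f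

end RelSchrodinger

end

/-! An eigenfunction at the bottom `l` of the spectrum has constant phase, and a function that is
odd under `S` cannot have constant phase unless it vanishes. As `S` preserves both the symbol and
the well, `f - f ∘ S` is a solution of the same eigenvalue equation, and it is odd; hence it is
zero. No simplicity or existence statement for the ground state is required.

Constant phase (`exists_phase_of_eigenvector`) comes from a comparison of `u` with `|u|`. By
subordination (`exists_energy_eq_lintegral_heatForm`) the kinetic energy is a positive superposition
of `‖u‖² - exp (-sM) ⟨u, exp (sΔ) u⟩`. In position space the heat form is a double integral of `u x
* conj (u y)` against a strictly positive kernel (`integral_gaussian_mul_fourier_eq`), so passing to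
`|u|` can only lower the energy, and equality forces the phases at almost all pairs of points to
agree (`exists_phase_of_energy_le`).

Equality holds because `l` minimises the form. A resolvent argument
(`le_re_inner_of_lt_mem_resolventSet`) bounds the form below by `l` on the operator domain, and
frequency truncation carries the bound to all of `L²` (`ofReal_potentialForm_le_energy`), in
particular to `|u|`, which need not lie in that domain. The potential side sees only `|u|`, and an
eigenfunction attains the bound. -/

set_option linter.unusedSectionVars false

noncomputable section

namespace RelSchrodinger

/-! ### The heat form in Fourier space and in position space -/

section Heat

open scoped ComplexConjugate

variable {V : Type*} [NormedAddCommGroup V] [InnerProductSpace ℝ V] [FiniteDimensional ℝ V]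
  [MeasurableSpace V] [BorelSpace V]

/-- The probability density whose Fourier transform is `exp (-b |ξ|²)`. -/
def heatKernel (b : ℝ) (x : V) : ℝ :=
  (Real.pi / b) ^ (Module.finrank ℝ V / 2 : ℝ) * Real.exp (-(Real.pi ^ 2 / b) * ‖x‖ ^ 2)

theorem heatKernel_pos {b : ℝ} (hb : 0 < b) (x : V) : 0 < heatKernel b x := by
  unfold heatKernel
  have := Real.pi_pos
  positivity

theorem continuous_heatKernel (b : ℝ) : Continuous (heatKernel b : V → ℝ) := by
  unfold heatKernel
  fun_prop

theorem integral_heatKernel {b : ℝ} (hb : 0 < b) : ∫ x : V, heatKernel b x = 1 := by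
  have hpi := Real.pi_pos
  unfold heatKernel
  rw [integral_const_mul, GaussianFourier.integral_rexp_neg_mul_sq_norm (by positivity),
    ← Real.mul_rpow (by positivity) (by positivity)]
  have : Real.pi / b * (Real.pi / (Real.pi ^ 2 / b)) = 1 := by field_simp
  rw [this, Real.one_rpow]

theorem lintegral_heatKernel {b : ℝ} (hb : 0 < b) :
    ∫⁻ x : V, ENNReal.ofReal (heatKernel b x) = 1 := by
  have h1 := integral_heatKernel (V := V) hb
  rw [← ofReal_integral_eq_lintegral_ofReal, h1, ENNReal.ofReal_one]
  · by_contra h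
    rw [integral_undef h] at h1
    exact zero_ne_one h1
  · exact Filter.Eventually.of_forall fun x => (heatKernel_pos hb x).le

variable (V) in
/-- The law `p_b (y - x) dx dy` of a Brownian pair started from Lebesgue measure. -/
def heatMeasure (b : ℝ) : Measure (V × V) :=
  (volume.prod volume).withDensity fun z => ENNReal.ofReal (heatKernel b (z.2 - z.1))

theorem measurable_heatDensity (b : ℝ) :
    Measurable fun z : V × V => ENNReal.ofReal (heatKernel b (z.2 - z.1)) :=
  (ENNReal.continuous_ofReal.comp
    ((continuous_heatKernel b).comp (continuous_snd.sub continuous_fst))).measurable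

/-- The kernel has mass one. With both marginals equal to Lebesgue measure, pulling back along
either projection is an isometry of `L²`, so the double integral is a bounded form on `L²`. -/
theorem measurePreserving_fst_heatMeasure {b : ℝ} (hb : 0 < b) :
    MeasurePreserving Prod.fst (heatMeasure V b) volume := by
  refine ⟨measurable_fst, ?_⟩
  ext s hs
  rw [Measure.map_apply measurable_fst hs, heatMeasure,
    withDensity_apply _ (measurable_fst hs), ← Set.prod_univ, ← Measure.prod_restrict,
    lintegral_prod _ (measurable_heatDensity b).aemeasurable]
  have : ∀ x : V, ∫⁻ y : V in Set.univ, ENNReal.ofReal (heatKernel b (y - x)) = 1 := by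
    intro x
    rw [Measure.restrict_univ,
      lintegral_sub_right_eq_self (fun y => ENNReal.ofReal (heatKernel b y)) x,
      lintegral_heatKernel hb]
  simp only [this, lintegral_one, Measure.restrict_apply_univ]

theorem measurePreserving_snd_heatMeasure {b : ℝ} (hb : 0 < b) :
    MeasurePreserving Prod.snd (heatMeasure V b) volume := by
  refine ⟨measurable_snd, ?_⟩
  ext s hs
  rw [Measure.map_apply measurable_snd hs, heatMeasure,
    withDensity_apply _ (measurable_snd hs), ← Set.univ_prod, ← Measure.prod_restrict,
    lintegral_prod_symm _ (measurable_heatDensity b).aemeasurable]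
  have : ∀ y : V, ∫⁻ x : V in Set.univ, ENNReal.ofReal (heatKernel b (y - x)) = 1 := by
    intro y
    rw [Measure.restrict_univ,
      lintegral_sub_left_eq_self (fun y => ENNReal.ofReal (heatKernel b y)) y,
      lintegral_heatKernel hb]
  simp only [this, lintegral_one, Measure.restrict_apply_univ]

/-- The density vanishes nowhere. This is the source of positivity improvement, as opposed to mere
positivity preservation. -/
theorem ae_prod_of_ae_heatMeasure {b : ℝ} (hb : 0 < b) {p : V × V → Prop}
    (h : ∀ᵐ z ∂(heatMeasure V b), p z) : ∀ᵐ z ∂((volume : Measure V).prod volume), p z := by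
  rw [heatMeasure, ae_withDensity_iff (measurable_heatDensity b)] at h
  filter_upwards [h] with z hz
  exact hz (ENNReal.ofReal_pos.2 (heatKernel_pos hb _)).ne'

/-- The Gaussian `exp (-b |ξ|²)`. -/
def gaussian (b : ℝ) (ξ : V) : ℂ := Complex.exp (-b * ‖ξ‖ ^ 2)

theorem gaussian_eq_ofReal (b : ℝ) (ξ : V) :
    gaussian b ξ = (Real.exp (-b * ‖ξ‖ ^ 2) : ℝ) := by
  simp [gaussian]

theorem continuous_gaussian (b : ℝ) : Continuous (gaussian b : V → ℂ) := by
  unfold gaussian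
  fun_prop

theorem norm_gaussian_le {b : ℝ} (hb : 0 < b) (ξ : V) : ‖gaussian b ξ‖ ≤ 1 := by
  rw [gaussian_eq_ofReal, Complex.norm_real, Real.norm_of_nonneg (Real.exp_pos _).le,
    Real.exp_le_one_iff]
  have : 0 ≤ b * ‖ξ‖ ^ 2 := by positivity
  linarith

theorem fourier_modulated_gaussian {b : ℝ} (hb : 0 < b) (x y : V) :
    𝓕 (fun ξ : V => Complex.exp (2 * Real.pi * Complex.I * inner ℝ y ξ) * gaussian b ξ) x
      = (heatKernel b (y - x) : ℝ) := by
  have h := fourier_gaussian_innerProductSpace' (b := (b : ℂ)) (by simpa using hb) y x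
  rw [show (fun ξ : V => Complex.exp (2 * Real.pi * Complex.I * inner ℝ y ξ) * gaussian b ξ)
    = fun v => Complex.exp (-b * ‖v‖ ^ 2 + 2 * Real.pi * Complex.I * inner ℝ y v) from by
      funext v; rw [gaussian, ← Complex.exp_add, add_comm], h, heatKernel]
  push_cast
  rw [Complex.ofReal_cpow (by have := Real.pi_pos; positivity)]
  push_cast
  congr 2
  ring

theorem integrable_modulated_gaussian {b : ℝ} (hb : 0 < b) (y : V) :
    Integrable fun ξ : V => Complex.exp (2 * Real.pi * Complex.I * inner ℝ y ξ) * gaussian b ξ := by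
  refine (GaussianFourier.integrable_cexp_neg_mul_sq_norm_add (b := (b : ℂ))
    (by simpa using hb) (2 * Real.pi * Complex.I) y).congr (Filter.Eventually.of_forall fun v => ?_)
  simp only [gaussian, ← Complex.exp_add]
  rw [add_comm]

theorem integrable_gaussian {b : ℝ} (hb : 0 < b) : Integrable (gaussian b : V → ℂ) := by
  simpa using integrable_modulated_gaussian hb (0 : V)

theorem integral_fourier_mul_modulated_gaussian {b : ℝ} (hb : 0 < b) {u : V → ℂ}
    (hu : Integrable u) (y : V) :
    ∫ ξ, 𝓕 u ξ * (Complex.exp (2 * Real.pi * Complex.I * inner ℝ y ξ) * gaussian b ξ)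
      = ∫ x, u x * (heatKernel b (y - x) : ℝ) := by
  have h := VectorFourier.integral_fourierIntegral_smul_eq_flip (L := innerₗ V)
    (μ := volume) (ν := volume)
    Real.continuous_fourierChar continuous_inner hu (integrable_modulated_gaussian hb y)
  simp only [flip_innerₗ, smul_eq_mul] at h
  refine h.trans (integral_congr_ae (Filter.Eventually.of_forall fun x => ?_))
  exact congrArg (u x * ·) (fourier_modulated_gaussian hb x y)

theorem conj_fourier (u : V → ℂ) (ξ : V) :
    conj (𝓕 u ξ) = ∫ y, Complex.exp (2 * Real.pi * Complex.I * inner ℝ y ξ) * conj (u y) := by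
  rw [Real.fourier_eq', ← integral_conj]
  refine integral_congr_ae (Filter.Eventually.of_forall fun y => ?_)
  simp only [smul_eq_mul, map_mul, ← Complex.exp_conj]
  congr 2
  simp only [Complex.conj_ofReal, Complex.conj_I]
  push_cast
  ring

theorem integrable_prod_heatMeasure {b : ℝ} (hb : 0 < b) {u : V → ℂ} (hu : MemLp u 2) :
    Integrable (fun z : V × V => u z.1 * conj (u z.2)) (heatMeasure V b) :=
  MemLp.integrable_mul (p := 2) (q := 2)
    (hu.comp_measurePreserving (measurePreserving_fst_heatMeasure hb))
    ((hu.comp_measurePreserving (measurePreserving_snd_heatMeasure hb)).star)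

/-- Write the conjugated transform as an integral over `y` and apply Fubini; the remaining `ξ`
integral is a Gaussian convolution of `u` at `y`. Integrability of `u` justifies the swap, and
square integrability the return to a double integral. -/
theorem integral_gaussian_mul_fourier_mul_conj {b : ℝ} (hb : 0 < b) {u : V → ℂ}
    (hu : Integrable u) (hu2 : MemLp u 2) :
    ∫ ξ, gaussian b ξ * (𝓕 u ξ * conj (𝓕 u ξ))
      = ∫ z, u z.1 * conj (u z.2) ∂(heatMeasure V b) := by
  have hcont : Continuous (𝓕 u) :=
    VectorFourier.fourierIntegral_continuous Real.continuous_fourierChar continuous_inner hu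
  have hbdd : ∀ ξ, ‖𝓕 u ξ‖ ≤ ∫ x, ‖u x‖ := fun ξ =>
    VectorFourier.norm_fourierIntegral_le_integral_norm _ _ _ _ _
  have hF : Integrable (fun ξ => gaussian b ξ * 𝓕 u ξ) :=
    (integrable_gaussian hb).mul_bdd (c := ∫ x, ‖u x‖) hcont.aestronglyMeasurable
      (Filter.Eventually.of_forall hbdd)
  have hprod : Integrable (Function.uncurry fun ξ y : V => (gaussian b ξ * 𝓕 u ξ) *
      (Complex.exp (2 * Real.pi * Complex.I * inner ℝ y ξ) * conj (u y)))
      (volume.prod volume) := by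
    have h1 := hF.mul_prod (memLp_one_iff_integrable.1 (memLp_one_iff_integrable.2 hu).star)
    have h2 : Integrable (fun z : V × V => Complex.exp (2 * Real.pi * Complex.I * inner ℝ z.2 z.1)
        * ((gaussian b z.1 * 𝓕 u z.1) * star (u z.2))) (volume.prod volume) := by
      refine h1.bdd_mul (c := 1) ?_ ?_
      · exact Continuous.aestronglyMeasurable (by fun_prop)
      · refine Filter.Eventually.of_forall fun z => ?_
        rw [Complex.norm_exp]
        simp
    refine h2.congr (Filter.Eventually.of_forall fun z => ?_)
    simp only [Function.uncurry, Complex.star_def]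
    ring
  calc ∫ ξ, gaussian b ξ * (𝓕 u ξ * conj (𝓕 u ξ))
      = ∫ ξ, ∫ y, (gaussian b ξ * 𝓕 u ξ) *
          (Complex.exp (2 * Real.pi * Complex.I * inner ℝ y ξ) * conj (u y)) := by
        refine integral_congr_ae (Filter.Eventually.of_forall fun ξ => ?_)
        simp only
        rw [integral_const_mul, ← conj_fourier, mul_assoc]
    _ = ∫ y, ∫ ξ, (gaussian b ξ * 𝓕 u ξ) *
          (Complex.exp (2 * Real.pi * Complex.I * inner ℝ y ξ) * conj (u y)) :=
        integral_integral_swap hprod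
    _ = ∫ y, ∫ x, heatKernel b (y - x) • (u x * conj (u y)) := by
        refine integral_congr_ae (Filter.Eventually.of_forall fun y => ?_)
        have := integral_fourier_mul_modulated_gaussian hb hu y
        calc ∫ ξ, (gaussian b ξ * 𝓕 u ξ) *
              (Complex.exp (2 * Real.pi * Complex.I * inner ℝ y ξ) * conj (u y))
            = ∫ ξ, (𝓕 u ξ * (Complex.exp (2 * Real.pi * Complex.I * inner ℝ y ξ)
                * gaussian b ξ)) * conj (u y) := by
              refine integral_congr_ae (Filter.Eventually.of_forall fun ξ => ?_)
              simp only
              ring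
          _ = (∫ x, u x * (heatKernel b (y - x) : ℝ)) * conj (u y) := by
              rw [integral_mul_const, this]
          _ = ∫ x, heatKernel b (y - x) • (u x * conj (u y)) := by
              rw [← integral_mul_const]
              refine integral_congr_ae (Filter.Eventually.of_forall fun x => ?_)
              simp only [Complex.real_smul]
              ring
    _ = ∫ z, heatKernel b (z.2 - z.1) • (u z.1 * conj (u z.2)) ∂(volume.prod volume) := by
        have hint := integrable_prod_heatMeasure hb hu2
        rw [heatMeasure, integrable_withDensity_iff_integrable_smul' (measurable_heatDensity b)
          (Filter.Eventually.of_forall fun _ => ENNReal.ofReal_lt_top)] at hint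
        simp only [ENNReal.toReal_ofReal (heatKernel_pos hb _).le] at hint
        rw [integral_prod_symm _ hint]
    _ = ∫ z, u z.1 * conj (u z.2) ∂(heatMeasure V b) := by
        rw [heatMeasure, integral_withDensity_eq_integral_toReal_smul (measurable_heatDensity b)
          (Filter.Eventually.of_forall fun _ => ENNReal.ofReal_lt_top)]
        simp only [ENNReal.toReal_ofReal (heatKernel_pos hb _).le]

/-- Multiplication by a bounded function as a bounded operator on `L²`. -/
def bddMul {g : V → ℂ} (hg : MemLp g ⊤) : Lp ℂ 2 (volume : Measure V) →L[ℂ] Lp ℂ 2 (volume : Measure V) :=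
  (ContinuousLinearMap.mul ℂ ℂ).holderL volume ⊤ 2 2 (hg.toLp g)

theorem coeFn_bddMul {g : V → ℂ} (hg : MemLp g ⊤) (u : Lp ℂ 2 (volume : Measure V)) :
    bddMul hg u =ᵐ[volume] fun x => g x * u x := by
  refine (ContinuousLinearMap.coeFn_holder (r := 2) (ContinuousLinearMap.mul ℂ ℂ)
    (hg.toLp g) u).trans ?_
  filter_upwards [hg.coeFn_toLp] with x hx
  simp [hx]

theorem memLp_top_gaussian {b : ℝ} (hb : 0 < b) : MemLp (gaussian b : V → ℂ) ⊤ :=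
  memLp_top_of_bound (continuous_gaussian b).aestronglyMeasurable 1
    (Filter.Eventually.of_forall (norm_gaussian_le hb))

theorem inner_bddMul {g : V → ℂ} (hg : MemLp g ⊤) (u w : Lp ℂ 2 (volume : Measure V)) :
    inner ℂ u (bddMul hg w) = ∫ x, g x * (w x * conj (u x)) := by
  rw [L2.inner_def]
  refine integral_congr_ae ?_
  filter_upwards [coeFn_bddMul hg w] with x hx
  simp only [hx, RCLike.inner_apply]
  ring

theorem integral_gaussian_mul_fourier_toLp {b : ℝ} (hb : 0 < b) (f : SchwartzMap V ℂ) :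
    ∫ ξ, gaussian b ξ * ((𝓕 (f.toLp 2 volume) : Lp ℂ 2 (volume : Measure V)) ξ
        * conj ((𝓕 (f.toLp 2 volume) : Lp ℂ 2 (volume : Measure V)) ξ))
      = ∫ z, f.toLp 2 volume z.1 * conj (f.toLp 2 volume z.2) ∂(heatMeasure V b) := by
  have hf2 : ∀ᵐ x, f.toLp 2 volume x = f x := f.coeFn_toLp 2 volume
  have h := integral_gaussian_mul_fourier_mul_conj hb f.integrable (f.memLp 2 volume)
  rw [SchwartzMap.toLp_fourier_eq]
  refine Eq.trans ?_ (h.trans ?_)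
  · refine integral_congr_ae ?_
    filter_upwards [(𝓕 f).coeFn_toLp 2 (volume : Measure V)] with ξ hξ
    rw [hξ, SchwartzMap.fourier_coe]
  · refine integral_congr_ae ?_
    filter_upwards [(measurePreserving_fst_heatMeasure hb).quasiMeasurePreserving.ae hf2,
      (measurePreserving_snd_heatMeasure hb).quasiMeasurePreserving.ae hf2] with z h1 h2
    rw [h1, h2]

/-- The quadratic form of the heat semigroup, in Fourier space and in position space. -/
theorem integral_gaussian_mul_fourier_eq {b : ℝ} (hb : 0 < b) (u : Lp ℂ 2 (volume : Measure V)) :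
    ∫ ξ, gaussian b ξ * ((𝓕 u : Lp ℂ 2 (volume : Measure V)) ξ
        * conj ((𝓕 u : Lp ℂ 2 (volume : Measure V)) ξ))
      = ∫ z, u z.1 * conj (u z.2) ∂(heatMeasure V b) := by
  -- Both sides become inner products of bounded operators applied to `u`, hence continuous on `L²`,
  -- and Schwartz functions are dense.
  let F := Lp.compMeasurePreservingₗᵢ (E := ℂ) (p := 2) ℂ Prod.fst
    (measurePreserving_fst_heatMeasure (V := V) hb)
  let G := Lp.compMeasurePreservingₗᵢ (E := ℂ) (p := 2) ℂ Prod.snd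
    (measurePreserving_snd_heatMeasure (V := V) hb)
  have hR : ∀ u : Lp ℂ 2 (volume : Measure V), inner ℂ (G u) (F u)
      = ∫ z, u z.1 * conj (u z.2) ∂(heatMeasure V b) := by
    intro u
    rw [L2.inner_def]
    refine integral_congr_ae ?_
    filter_upwards [Lp.coeFn_compMeasurePreserving u (measurePreserving_fst_heatMeasure hb),
      Lp.coeFn_compMeasurePreserving u (measurePreserving_snd_heatMeasure hb)] with z h1 h2
    change inner ℂ (Lp.compMeasurePreserving _ _ u z) (Lp.compMeasurePreserving _ _ u z) = _
    rw [h1, h2]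
    simp [RCLike.inner_apply]
  rw [← inner_bddMul (memLp_top_gaussian hb), ← hR]
  refine DenseRange.induction_on
    (p := fun u : Lp ℂ 2 (volume : Measure V) =>
      inner ℂ (𝓕 u) (bddMul (memLp_top_gaussian hb) (𝓕 u)) = inner ℂ (G u) (F u))
    (SchwartzMap.denseRange_toLpCLM (E := V) (F := ℂ) (p := 2) (μ := volume)
      ENNReal.ofNat_ne_top) u ?_ ?_
  · refine isClosed_eq ?_ ?_
    · have h : Continuous fun u : Lp ℂ 2 (volume : Measure V) => 𝓕 u :=
        FourierTransform.continuous_fourier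
      exact h.inner ((bddMul _).continuous.comp h)
    · exact G.continuous.inner F.continuous
  · intro f
    have hf : (SchwartzMap.toLpCLM ℝ ℂ 2 (volume : Measure V)) f = f.toLp 2 volume := rfl
    rw [hf, hR, inner_bddMul]
    exact integral_gaussian_mul_fourier_toLp hb f

end Heat

/-! ### Heat form and energy under passage to the modulus -/

section Positivity

open scoped ComplexConjugate

variable {V : Type*} [NormedAddCommGroup V] [InnerProductSpace ℝ V] [FiniteDimensional ℝ V]
  [MeasurableSpace V] [BorelSpace V]

/-- The quadratic form `⟨u, exp (b Δ / 4π²) u⟩` of the heat semigroup. -/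
def heatForm (b : ℝ) (u : Lp ℂ 2 (volume : Measure V)) : ℝ :=
  ∫ ξ, Real.exp (-b * ‖ξ‖ ^ 2) * ‖(𝓕 u : Lp ℂ 2 (volume : Measure V)) ξ‖ ^ 2

theorem heatForm_eq {b : ℝ} (hb : 0 < b) (u : Lp ℂ 2 (volume : Measure V)) :
    heatForm b u = ∫ z, (u z.1 * conj (u z.2)).re ∂(heatMeasure V b) := by
  have h := integral_gaussian_mul_fourier_eq hb u
  have h1 : ((heatForm b u : ℝ) : ℂ) = ∫ z, u z.1 * conj (u z.2) ∂(heatMeasure V b) := by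
    rw [← h, heatForm, ← integral_complex_ofReal]
    refine integral_congr_ae (Filter.Eventually.of_forall fun ξ => ?_)
    simp only [Complex.mul_conj, gaussian_eq_ofReal, Complex.normSq_eq_norm_sq]
    push_cast
    rfl
  have h2 := integral_re (integrable_prod_heatMeasure hb (Lp.memLp u))
  rw [← h1] at h2
  exact h2.symm

/-- The modulus of an element of `L²`. -/
def absLp (u : Lp ℂ 2 (volume : Measure V)) : Lp ℂ 2 (volume : Measure V) :=
  ((Lp.memLp u).norm.ofReal (K := ℂ)).toLp

theorem coeFn_absLp (u : Lp ℂ 2 (volume : Measure V)) :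
    absLp u =ᵐ[volume] fun x => (‖u x‖ : ℂ) :=
  MemLp.coeFn_toLp _

theorem norm_absLp (u : Lp ℂ 2 (volume : Measure V)) : ‖absLp u‖ = ‖u‖ := by
  refine le_antisymm (Lp.norm_le_norm_of_ae_le ?_) (Lp.norm_le_norm_of_ae_le ?_) <;>
  · filter_upwards [coeFn_absLp u] with x hx
    simp [hx]

theorem heatForm_absLp {b : ℝ} (hb : 0 < b) (u : Lp ℂ 2 (volume : Measure V)) :
    heatForm b (absLp u) = ∫ z, ‖u z.1 * conj (u z.2)‖ ∂(heatMeasure V b) := by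
  rw [heatForm_eq hb]
  refine integral_congr_ae ?_
  filter_upwards [(measurePreserving_fst_heatMeasure hb).quasiMeasurePreserving.ae (coeFn_absLp u),
    (measurePreserving_snd_heatMeasure hb).quasiMeasurePreserving.ae (coeFn_absLp u)] with z h1 h2
  simp [h1, h2]

theorem heatForm_le_heatForm_absLp {b : ℝ} (hb : 0 < b) (u : Lp ℂ 2 (volume : Measure V)) :
    heatForm b u ≤ heatForm b (absLp u) := by
  have hint := integrable_prod_heatMeasure hb (Lp.memLp u)
  rw [heatForm_eq hb, heatForm_absLp hb]
  exact integral_mono hint.re hint.norm fun z => Complex.re_le_norm _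

/-- Fix one point `x` with `u x ≠ 0` at which the relation holds for almost every partner `y`. Then
`u x * conj (u y)` is nonnegative, so `u y` carries the phase of `u x`. -/
theorem exists_phase_of_ae_prod {u : V → ℂ}
    (h : ∀ᵐ z ∂((volume : Measure V).prod volume), ‖u z.1 * conj (u z.2)‖
      = (u z.1 * conj (u z.2)).re) :
    ∃ c : ℂ, ∀ᵐ x, u x = c * ‖u x‖ := by
  by_cases h0 : ∀ᵐ x, u x = 0
  · refine ⟨0, ?_⟩
    filter_upwards [h0] with x hx
    rw [hx, zero_mul]
  obtain ⟨x, hx0, hx⟩ := ((Filter.not_eventually.1 h0).and_eventually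
    (Measure.ae_ae_of_ae_prod h)).exists
  refine ⟨u x / ‖u x‖, ?_⟩
  filter_upwards [hx] with y hy
  have h1 : u x * conj (u y) = (‖u x * conj (u y)‖ : ℝ) :=
    Complex.eq_coe_norm_of_nonneg (Complex.re_eq_norm.1 hy.symm)
  have h2 : conj (u x) * u y = ‖u x‖ * ‖u y‖ := by
    have := congrArg conj h1
    simpa using this
  have hn : (‖u x‖ : ℂ) ≠ 0 := by simpa using hx0
  have h3 : u x * conj (u x) = (‖u x‖ : ℂ) ^ 2 := by
    rw [Complex.mul_conj, Complex.normSq_eq_norm_sq]; push_cast; rfl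
  have h4 : (‖u x‖ : ℂ) ^ 2 * u y = u x * ‖u x‖ * ‖u y‖ := by
    rw [← h3, mul_assoc, h2, mul_assoc]
  have h5 : (‖u x‖ : ℂ) * (‖u x‖ * u y - u x * ‖u y‖) = 0 := by
    linear_combination h4
  rcases mul_eq_zero.1 h5 with h6 | h6
  · exact absurd h6 hn
  · field_simp
    linear_combination h6

/-- The heat semigroup is positivity improving. -/
theorem exists_phase_of_heatForm_eq {b : ℝ} (hb : 0 < b) {u : Lp ℂ 2 (volume : Measure V)}
    (h : heatForm b (absLp u) = heatForm b u) : ∃ c : ℂ, ∀ᵐ x, u x = c * ‖u x‖ := by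
  have hint := integrable_prod_heatMeasure hb (Lp.memLp u)
  rw [heatForm_absLp hb, heatForm_eq hb] at h
  have h1 := (integral_eq_iff_of_ae_le hint.re hint.norm
    (Filter.Eventually.of_forall fun z => Complex.re_le_norm _)).1 h.symm
  refine exists_phase_of_ae_prod (ae_prod_of_ae_heatMeasure hb ?_)
  filter_upwards [h1] with z hz
  exact hz.symm

/-! ### Subordination of fractional powers to the heat semigroup -/

/-- Near zero `1 - exp (-s) ≤ s` leaves `s ^ (-a)`, integrable as `a < 1`; beyond one the factor is
at most `1`, and `0 < a` gives the decay. -/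
theorem integrableOn_one_sub_exp_mul_rpow {a : ℝ} (ha0 : 0 < a) (ha1 : a < 1) :
    IntegrableOn (fun s : ℝ => (1 - Real.exp (-s)) * s ^ (-1 - a)) (Set.Ioi 0) := by
  have hmeas : AEStronglyMeasurable (fun s : ℝ => (1 - Real.exp (-s)) * s ^ (-1 - a)) volume :=
    (by fun_prop : Measurable fun s : ℝ =>
      (1 - Real.exp (-s)) * s ^ (-1 - a)).aestronglyMeasurable
  rw [← Set.Ioc_union_Ioi_eq_Ioi zero_le_one]
  refine IntegrableOn.union ?_ ?_
  · have h : IntegrableOn (fun s : ℝ => s ^ (-a)) (Set.Ioc 0 1) :=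
      (intervalIntegrable_iff_integrableOn_Ioc_of_le zero_le_one).1
        (intervalIntegral.intervalIntegrable_rpow' (by linarith))
    refine Integrable.mono' h hmeas.restrict ?_
    filter_upwards [ae_restrict_mem measurableSet_Ioc] with s hs
    have hs0 : 0 < s := hs.1
    have h1 : 0 ≤ 1 - Real.exp (-s) := by
      rw [sub_nonneg, Real.exp_le_one_iff]; linarith
    have h2 : 1 - Real.exp (-s) ≤ s := by linarith [Real.add_one_le_exp (-s)]
    rw [Real.norm_of_nonneg (by positivity)]
    calc (1 - Real.exp (-s)) * s ^ (-1 - a) ≤ s * s ^ (-1 - a) := by gcongr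
      _ = s ^ (-a) := by
        rw [← Real.rpow_one_add' hs0.le (by linarith)]
        congr 1
        ring
  · have h : IntegrableOn (fun s : ℝ => s ^ (-1 - a)) (Set.Ioi 1) :=
      integrableOn_Ioi_rpow_of_lt (by linarith) zero_lt_one
    refine Integrable.mono' h hmeas.restrict ?_
    filter_upwards [ae_restrict_mem measurableSet_Ioi] with s hs
    have hs0 : 0 < s := zero_lt_one.trans hs
    have h1 : 0 ≤ 1 - Real.exp (-s) := by
      rw [sub_nonneg, Real.exp_le_one_iff]; linarith
    have h2 : 1 - Real.exp (-s) ≤ 1 := by linarith [Real.exp_pos (-s)]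
    rw [Real.norm_of_nonneg (by positivity)]
    calc (1 - Real.exp (-s)) * s ^ (-1 - a) ≤ 1 * s ^ (-1 - a) := by gcongr
      _ = s ^ (-1 - a) := one_mul _

/-- The Lévy–Khintchine representation of the power `y ^ a`, `0 < a < 1`. -/
theorem exists_lintegral_one_sub_exp_eq_rpow {a : ℝ} (ha0 : 0 < a) (ha1 : a < 1) :
    ∃ C : ℝ, 0 < C ∧ ∀ y : ℝ, 0 ≤ y →
      ∫⁻ s in Set.Ioi (0 : ℝ), ENNReal.ofReal ((1 - Real.exp (-(s * y))) * s ^ (-1 - a))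
        = ENNReal.ofReal (C * y ^ a) := by
  set f : ℝ → ℝ := fun s => (1 - Real.exp (-s)) * s ^ (-1 - a) with hf
  have hint := integrableOn_one_sub_exp_mul_rpow ha0 ha1
  have hpos : ∀ s ∈ Set.Ioi (0 : ℝ), 0 < f s := by
    intro s hs
    have hs0 : 0 < s := hs
    have : 0 < 1 - Real.exp (-s) := by
      rw [sub_pos, Real.exp_lt_one_iff]; linarith
    positivity
  refine ⟨∫ s in Set.Ioi (0 : ℝ), f s, ?_, ?_⟩
  · rw [setIntegral_pos_iff_support_of_nonneg_ae _ hint]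
    · have : Set.Ioi (0 : ℝ) ⊆ Function.support f ∩ Set.Ioi 0 := fun s hs =>
        ⟨(hpos s hs).ne', hs⟩
      refine lt_of_lt_of_le ?_ (measure_mono this)
      simp
    · filter_upwards [ae_restrict_mem measurableSet_Ioi] with s hs
      exact (hpos s hs).le
  intro y hy
  rcases hy.eq_or_lt with rfl | hy0
  · simp [Real.zero_rpow ha0.ne']
  -- Scaling `s` by `y` reduces to the case `y = 1`, whose value is the constant; the Jacobian `y⁻¹`
  -- turns `y ^ (1 + a)` into `y ^ a`.
  have heq : ∀ s ∈ Set.Ioi (0 : ℝ), (1 - Real.exp (-(s * y))) * s ^ (-1 - a)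
      = y ^ (1 + a) * f (y * s) := by
    intro s hs
    have hs0 : 0 < s := hs
    simp only [hf]
    rw [Real.mul_rpow hy0.le hs0.le, mul_comm s y]
    have : y ^ (1 + a) * y ^ (-1 - a) = 1 := by
      rw [← Real.rpow_add hy0]; simp
    linear_combination (-(1 - Real.exp (-(y * s))) * s ^ (-1 - a)) * this
  have hint2 : IntegrableOn (fun s => f (y * s)) (Set.Ioi 0) := by
    rw [integrableOn_Ioi_comp_mul_left_iff _ _ hy0, mul_zero]
    exact hint
  rw [setLIntegral_congr_fun measurableSet_Ioi
      (fun s hs => congrArg ENNReal.ofReal (heq s hs)),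
    ← ofReal_integral_eq_lintegral_ofReal (hint2.const_mul _), integral_const_mul,
    integral_comp_mul_left_Ioi _ _ hy0, mul_zero, smul_eq_mul]
  · congr 1
    rw [Real.rpow_add hy0, Real.rpow_one]
    field_simp
  · filter_upwards [ae_restrict_mem measurableSet_Ioi] with s hs
    rw [← heq s hs]
    have hs0 : 0 < s := hs
    have : 0 ≤ 1 - Real.exp (-(s * y)) := by
      rw [sub_nonneg, Real.exp_le_one_iff, neg_nonpos]; positivity
    positivity

/-- The quadratic form `∫ ((2π|ξ|)² + M) ^ a |𝓕 u|² dξ`, with values in `[0, ∞]`. -/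
def energy (M a : ℝ) (u : Lp ℂ 2 (volume : Measure V)) : ENNReal :=
  ∫⁻ ξ : V, ENNReal.ofReal (((2 * Real.pi * ‖ξ‖) ^ 2 + M) ^ a) *
    ENNReal.ofReal (‖(𝓕 u : Lp ℂ 2 (volume : Measure V)) ξ‖ ^ 2)

theorem integrable_norm_sq (u : Lp ℂ 2 (volume : Measure V)) :
    Integrable (fun x => ‖u x‖ ^ 2) :=
  (Lp.memLp u).integrable_norm_pow (by norm_num)

theorem integral_norm_sq (u : Lp ℂ 2 (volume : Measure V)) :
    ∫ x, ‖u x‖ ^ 2 = ‖u‖ ^ 2 := by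
  have h := inner_self_eq_norm_sq (𝕜 := ℂ) u
  rw [← h, L2.inner_def, ← integral_re (L2.integrable_inner u u)]
  refine integral_congr_ae (Filter.Eventually.of_forall fun x => ?_)
  exact (inner_self_eq_norm_sq (𝕜 := ℂ) (u x)).symm

theorem integrable_exp_mul_norm_sq {b : ℝ} (hb : 0 < b) (w : Lp ℂ 2 (volume : Measure V)) :
    Integrable fun ξ : V => Real.exp (-b * ‖ξ‖ ^ 2) * ‖w ξ‖ ^ 2 := by
  refine (integrable_norm_sq w).bdd_mul (c := 1) (Continuous.aestronglyMeasurable (by fun_prop)) ?_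
  refine Filter.Eventually.of_forall fun ξ => ?_
  have := norm_gaussian_le hb ξ
  rwa [gaussian_eq_ofReal, Complex.norm_real] at this

theorem heatForm_le_norm_sq {b : ℝ} (hb : 0 < b) (u : Lp ℂ 2 (volume : Measure V)) :
    heatForm b u ≤ ‖u‖ ^ 2 := by
  rw [← Lp.norm_fourier_eq, ← integral_norm_sq]
  refine integral_mono (integrable_exp_mul_norm_sq hb _) (integrable_norm_sq _) fun ξ => ?_
  refine mul_le_of_le_one_left (by positivity) ?_
  rw [Real.exp_le_one_iff]
  have : 0 ≤ b * ‖ξ‖ ^ 2 := by positivity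
  linarith

/-- Plancherel handles the constant `1`. The exponential splits into `exp (-sM)` and a Gaussian,
whose parameter `s * (2π)²` reflects the normalisation of `𝓕`. -/
theorem lintegral_one_sub_exp_mul_norm_sq {M s : ℝ} (hM : 0 ≤ M) (hs : 0 < s)
    (u : Lp ℂ 2 (volume : Measure V)) :
    ∫⁻ ξ : V, ENNReal.ofReal (1 - Real.exp (-(s * ((2 * Real.pi * ‖ξ‖) ^ 2 + M)))) *
        ENNReal.ofReal (‖(𝓕 u : Lp ℂ 2 (volume : Measure V)) ξ‖ ^ 2)
      = ENNReal.ofReal (‖u‖ ^ 2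
          - Real.exp (-(s * M)) * heatForm (s * (2 * Real.pi) ^ 2) u) := by
  set w := (𝓕 u : Lp ℂ 2 (volume : Measure V)) with hw
  have hb : 0 < s * (2 * Real.pi) ^ 2 := by have := Real.pi_pos; positivity
  have hint1 : Integrable fun ξ => ‖w ξ‖ ^ 2 := integrable_norm_sq w
  have hint2 := integrable_exp_mul_norm_sq hb w
  have hnn : ∀ ξ : V, 0 ≤ 1 - Real.exp (-(s * ((2 * Real.pi * ‖ξ‖) ^ 2 + M))) := by
    intro ξ
    rw [sub_nonneg, Real.exp_le_one_iff, neg_nonpos]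
    positivity
  have heq : ∀ ξ : V, (1 - Real.exp (-(s * ((2 * Real.pi * ‖ξ‖) ^ 2 + M)))) * ‖w ξ‖ ^ 2
      = ‖w ξ‖ ^ 2 - Real.exp (-(s * M)) *
        (Real.exp (-(s * (2 * Real.pi) ^ 2) * ‖ξ‖ ^ 2) * ‖w ξ‖ ^ 2) := by
    intro ξ
    rw [← mul_assoc, ← Real.exp_add, sub_mul, one_mul]
    congr 3
    ring
  simp_rw [← ENNReal.ofReal_mul (hnn _), heq]
  rw [← ofReal_integral_eq_lintegral_ofReal, integral_sub hint1 (hint2.const_mul _),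
    integral_const_mul, integral_norm_sq, hw, Lp.norm_fourier_eq]
  · rfl
  · exact hint1.sub (hint2.const_mul _)
  · refine Filter.Eventually.of_forall fun ξ => ?_
    simp only [Pi.zero_apply]
    rw [← heq]
    exact mul_nonneg (hnn ξ) (by positivity)

/-- The subordination formula: the energy is a superposition of heat forms. -/
theorem exists_energy_eq_lintegral_heatForm {M a : ℝ} (hM : 0 ≤ M) (ha0 : 0 < a) (ha1 : a < 1) :
    ∃ C : ENNReal, C ≠ 0 ∧ C ≠ ⊤ ∧ ∀ u : Lp ℂ 2 (volume : Measure V),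
      AEMeasurable (fun s : ℝ => ENNReal.ofReal (s ^ (-1 - a)) * ENNReal.ofReal (‖u‖ ^ 2
          - Real.exp (-(s * M)) * heatForm (s * (2 * Real.pi) ^ 2) u))
        (volume.restrict (Set.Ioi 0)) ∧
      C * energy M a u = ∫⁻ s in Set.Ioi (0 : ℝ), ENNReal.ofReal (s ^ (-1 - a)) *
        ENNReal.ofReal (‖u‖ ^ 2
          - Real.exp (-(s * M)) * heatForm (s * (2 * Real.pi) ^ 2) u) := by
  obtain ⟨C, hC0, hC⟩ := exists_lintegral_one_sub_exp_eq_rpow ha0 ha1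
  refine ⟨ENNReal.ofReal C, (ENNReal.ofReal_pos.2 hC0).ne', ENNReal.ofReal_ne_top, fun u => ?_⟩
  set w := (𝓕 u : Lp ℂ 2 (volume : Measure V)) with hw
  -- Tonelli for `G`: integrating over `ξ` first gives the heat forms, over `s` first the power of
  -- the symbol.
  let G : V → ℝ → ENNReal := fun ξ s =>
    ENNReal.ofReal ((1 - Real.exp (-(s * ((2 * Real.pi * ‖ξ‖) ^ 2 + M)))) * s ^ (-1 - a)) *
      ENNReal.ofReal (‖w ξ‖ ^ 2)
  have hmeas : Measurable (Function.uncurry G) := by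
    have h1 : Measurable fun ξ => ‖w ξ‖ ^ 2 := by
      have := (Lp.stronglyMeasurable w).measurable
      fun_prop
    refine Measurable.mul ?_ (ENNReal.measurable_ofReal.comp (h1.comp measurable_fst))
    fun_prop
  have hinner : ∀ s ∈ Set.Ioi (0 : ℝ), ∫⁻ ξ, G ξ s = ENNReal.ofReal (s ^ (-1 - a)) *
        ENNReal.ofReal (‖u‖ ^ 2
          - Real.exp (-(s * M)) * heatForm (s * (2 * Real.pi) ^ 2) u) := by
    intro s hs
    have hs0 : 0 < s := hs
    rw [← lintegral_one_sub_exp_mul_norm_sq hM hs u, ← lintegral_const_mul']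
    · refine lintegral_congr fun ξ => ?_
      simp only [G]
      rw [mul_comm _ (s ^ (-1 - a)), ENNReal.ofReal_mul (by positivity), mul_assoc]
    · exact ENNReal.ofReal_ne_top
  constructor
  · refine (Measurable.lintegral_prod_left (μ := volume) hmeas).aemeasurable.congr ?_
    filter_upwards [ae_restrict_mem measurableSet_Ioi] with s hs
    exact hinner s hs
  · rw [← setLIntegral_congr_fun measurableSet_Ioi hinner,
      ← lintegral_lintegral_swap hmeas.aemeasurable, energy,
      ← lintegral_const_mul' _ _ ENNReal.ofReal_ne_top]
    refine lintegral_congr fun ξ => ?_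
    simp only [G]
    rw [lintegral_mul_const' _ _ ENNReal.ofReal_ne_top, hC _ (by positivity),
      ENNReal.ofReal_mul hC0.le, mul_assoc (ENNReal.ofReal C)]

/-- The heat forms enter the superposition with a minus sign and increase under the modulus, while
the norm stays fixed. -/
theorem energy_absLp_le {M a : ℝ} (hM : 0 ≤ M) (ha0 : 0 < a) (ha1 : a < 1)
    (u : Lp ℂ 2 (volume : Measure V)) : energy M a (absLp u) ≤ energy M a u := by
  obtain ⟨C, hC0, hC, h⟩ := exists_energy_eq_lintegral_heatForm (V := V) hM ha0 ha1
  rw [← ENNReal.mul_le_mul_iff_right hC0 hC, (h u).2, (h (absLp u)).2, norm_absLp]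
  refine setLIntegral_mono' measurableSet_Ioi fun s hs => ?_
  have hs0 : 0 < s := hs
  have := heatForm_le_heatForm_absLp
    (show 0 < s * (2 * Real.pi) ^ 2 by have := Real.pi_pos; positivity) u
  gcongr

/-- Taking the modulus of `u` strictly decreases the energy unless the phase is constant. -/
theorem exists_phase_of_energy_le {M a : ℝ} (hM : 0 ≤ M) (ha0 : 0 < a) (ha1 : a < 1)
    {u : Lp ℂ 2 (volume : Measure V)} (hfin : energy M a u ≠ ⊤)
    (hle : energy M a u ≤ energy M a (absLp u)) : ∃ c : ℂ, ∀ᵐ x, u x = c * ‖u x‖ := by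
  obtain ⟨C, hC0, hC, h⟩ := exists_energy_eq_lintegral_heatForm (V := V) hM ha0 ha1
  have hle' : C * energy M a u ≤ C * energy M a (absLp u) := by gcongr
  have hfin' : C * energy M a (absLp u) ≠ ⊤ :=
    ENNReal.mul_ne_top hC (ne_top_of_le_ne_top hfin (energy_absLp_le hM ha0 ha1 u))
  rw [(h u).2, (h (absLp u)).2] at hle'
  rw [(h (absLp u)).2] at hfin'
  have hbpos : ∀ s ∈ Set.Ioi (0 : ℝ), 0 < s * (2 * Real.pi) ^ 2 := fun s hs => by
    have := Real.pi_pos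
    have hs0 : 0 < s := hs
    positivity
  -- The integrands are ordered for each `s`, so the reversed inequality of finite integrals makes
  -- them equal almost everywhere. A single such `s` is enough.
  have hae := ae_eq_of_ae_le_of_lintegral_le ?_ hfin' (h u).1 hle'
  · have : (volume.restrict (Set.Ioi (0 : ℝ))) ≠ 0 := by simp
    have : (ae (volume.restrict (Set.Ioi (0 : ℝ)))).NeBot := ae_neBot.2 this
    obtain ⟨s, hs, hs0⟩ := (hae.and (ae_restrict_mem measurableSet_Ioi)).exists
    have hs1 : 0 < s := hs0
    have hb := hbpos s hs0
    refine exists_phase_of_heatForm_eq hb ?_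
    rw [norm_absLp, ENNReal.mul_right_inj (ENNReal.ofReal_pos.2 (by positivity)).ne'
      ENNReal.ofReal_ne_top] at hs
    -- Nonnegativity ensures that `ENNReal.ofReal` truncates nothing, so equality descends to the
    -- real heat forms.
    have hnn : ∀ w : Lp ℂ 2 (volume : Measure V), 0 ≤ ‖w‖ ^ 2
        - Real.exp (-(s * M)) * heatForm (s * (2 * Real.pi) ^ 2) w := by
      intro w
      have h1 := heatForm_le_norm_sq hb w
      have h2 : 0 ≤ heatForm (s * (2 * Real.pi) ^ 2) w :=
        integral_nonneg fun ξ => by positivity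
      have h3 : Real.exp (-(s * M)) ≤ 1 := by
        rw [Real.exp_le_one_iff, neg_nonpos]; positivity
      nlinarith [Real.exp_pos (-(s * M))]
    have h1 := hnn u
    have h2 := hnn (absLp u)
    rw [norm_absLp] at h2
    rw [ENNReal.ofReal_eq_ofReal_iff h2 h1] at hs
    have h3 := Real.exp_pos (-(s * M))
    have h4 : Real.exp (-(s * M)) * heatForm (s * (2 * Real.pi) ^ 2) (absLp u)
      = Real.exp (-(s * M)) * heatForm (s * (2 * Real.pi) ^ 2) u := by linarith
    exact mul_left_cancel₀ h3.ne' h4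
  · filter_upwards [ae_restrict_mem measurableSet_Ioi] with s hs
    have := heatForm_le_heatForm_absLp (hbpos s hs) u
    rw [norm_absLp]
    gcongr

end Positivity

/-! ### From the spectrum to a lower bound on the form -/

section Spectral

variable {X : Type*} [NormedAddCommGroup X]

/-- If `E + 1 / x` lies in the resolvent set of `T`, then `x` is not a spectral value of the
resolvent `R = (T - E)⁻¹`. -/
theorem isUnit_algebraMap_sub_resolvent [NormedSpace ℂ X] {T : X →ₗ.[ℂ] X} {E x : ℝ} (hx : x ≠ 0)
    {R : X →L[ℂ] X}
    (hR1 : ∀ g : X, ∃ h : R g ∈ T.domain, T ⟨R g, h⟩ - (E : ℂ) • R g = g)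
    (hR2 : ∀ f : T.domain, R (T f - (E : ℂ) • (f : X)) = f)
    (hx' : ((E + x⁻¹ : ℝ) : ℂ) ∈ resolventSet T) :
    IsUnit (algebraMap ℝ (X →L[ℂ] X) x - R) := by
  obtain ⟨S, hS1, hS2⟩ := hx'
  set y : ℂ := ((x⁻¹ : ℝ) : ℂ) with hy
  have hxy : (x : ℂ) * y = 1 := by
    rw [hy, ← Complex.ofReal_mul, mul_inv_cancel₀ hx, Complex.ofReal_one]
  have hE : ((E + x⁻¹ : ℝ) : ℂ) = E + y := by rw [hy]; push_cast; rfl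
  rw [hE] at hS1 hS2
  -- `h1` and `h2` are the resolvent identity between `E` and `E + y`, in both orders of
  -- composition.
  have h1 : ∀ g, S g = R g + y • R (S g) := by
    intro g
    obtain ⟨h, hg⟩ := hS1 g
    have h2 := hR2 ⟨S g, h⟩
    have h3 : T ⟨S g, h⟩ - (E : ℂ) • S g = g + y • S g := by
      rw [add_smul, ← sub_sub] at hg
      exact sub_eq_iff_eq_add.1 hg
    simp only [h3, map_add, map_smul] at h2
    exact h2.symm
  have h2 : ∀ g, R g = S g - y • S (R g) := by
    intro g
    obtain ⟨h, hg⟩ := hR1 g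
    have h2 := hS2 ⟨R g, h⟩
    have h3 : T ⟨R g, h⟩ - ((E : ℂ) + y) • R g = g - y • R g := by
      rw [add_smul, ← sub_sub, hg]
    simp only [h3, map_sub, map_smul] at h2
    exact h2.symm
  have hal : ∀ g, algebraMap ℝ (X →L[ℂ] X) x g = (x : ℂ) • g := by
    intro g
    rw [Algebra.algebraMap_eq_smul_one]
    simp
  -- With `y = 1 / x`, the resolvent identity suggests `(x - R)⁻¹ = y + y² S`.
  refine isUnit_iff_exists.2 ⟨y • 1 + (y * y) • S, ?_, ?_⟩
  · ext g
    simp only [mul_apply_eq_comp, sub_apply, hal,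
      add_apply, smul_apply, map_add, map_smul,
      one_apply_eq_self]
    have h3 := h1 g
    have h4 : R g = S g - y • R (S g) := by rw [eq_sub_iff_add_eq]; exact h3.symm
    rw [h4]
    match_scalars
    · linear_combination hxy
    · linear_combination y * hxy
    · ring
  · ext g
    simp only [mul_apply_eq_comp, sub_apply, hal,
      add_apply, smul_apply, map_sub, map_smul,
      one_apply_eq_self]
    have h3 := h2 g
    generalize S (R g) = c at h3 ⊢
    rw [h3]
    match_scalars
    · linear_combination hxy
    · linear_combination y * hxy
    · ring

variable [InnerProductSpace ℂ X] [CompleteSpace X]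

/-- A symmetric operator whose real spectrum is bounded below by `l` has its form bounded below
by `l`. -/
theorem le_re_inner_of_lt_mem_resolventSet {T : X →ₗ.[ℂ] X}
    (hT : ∀ f g : T.domain, inner ℂ (T f) (g : X) = inner ℂ (f : X) (T g)) {l : ℝ}
    (hl : ∀ r : ℝ, r < l → (r : ℂ) ∈ resolventSet T) (f : T.domain) :
    l * ‖(f : X)‖ ^ 2 ≤ (inner ℂ (T f) (f : X)).re := by
  obtain ⟨R, hR1, hR2⟩ := hl (l - 1) (by linarith)
  have hsymm : ∀ g h : X, inner ℂ (R g) h = inner ℂ g (R h) := by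
    intro g h
    obtain ⟨hg, hg'⟩ := hR1 g
    obtain ⟨hh, hh'⟩ := hR1 h
    conv_lhs => rw [← hh']
    conv_rhs => rw [← hg']
    rw [inner_sub_left, inner_sub_right, inner_smul_left, inner_smul_right, Complex.conj_ofReal]
    rw [← hT ⟨R g, hg⟩ ⟨R h, hh⟩]
  have hsa : IsSelfAdjoint R :=
    ContinuousLinearMap.isSelfAdjoint_iff_isSymmetric.2 hsymm
  -- Basing the resolvent at `l - 1` places the spectrum of `R` in `[0, 1]`: outside this interval
  -- `x⁻¹ < 1`, and `l - 1 + x⁻¹` falls below `l`.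
  have hspec : ∀ x ∈ spectrum ℝ R, 0 ≤ x - x ^ 2 := by
    intro x hx
    by_contra hneg
    have hx0 : x ≠ 0 := by rintro rfl; simp at hneg
    have hlt : l - 1 + x⁻¹ < l := by
      have : x⁻¹ < 1 := by
        rcases lt_or_gt_of_ne hx0 with h | h
        · exact (inv_lt_zero.2 h).trans zero_lt_one
        · refine inv_lt_one_of_one_lt₀ ?_
          nlinarith
      linarith
    exact hx (isUnit_algebraMap_sub_resolvent hx0 hR1 hR2 (hl _ hlt))
  have hpos : 0 ≤ R - R ^ 2 := by
    have h := cfc_nonneg (a := R) hspec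
    rwa [cfc_sub (R := ℝ) (fun x => x) (fun x => x ^ 2) R, cfc_pow_id R 2, cfc_id' ℝ R] at h
  rw [ContinuousLinearMap.nonneg_iff_isPositive] at hpos
  -- Since `R g = f`, the form of `R - R ^ 2` at `g` is `⟨f, T f⟩ - l ‖f‖²`.
  set g := T f - ((l - 1 : ℝ) : ℂ) • (f : X) with hg
  have h1 := hpos.re_inner_nonneg_left g
  have hRg : R g = f := hR2 f
  have h2 : (R - R ^ 2) g = f - R f := by
    simp [pow_two, hRg]
  rw [h2, inner_sub_left, hsymm, hRg, hg, inner_sub_right, inner_smul_right, ← hT f f] at h1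
  have h3 : inner ℂ (f : X) (f : X) = ((‖(f : X)‖ ^ 2 : ℝ) : ℂ) := by
    rw [inner_self_eq_norm_sq_to_K]; push_cast; rfl
  rw [h3, ← Complex.ofReal_mul, map_sub, map_sub] at h1
  simp only [RCLike.re_to_complex, Complex.ofReal_re] at h1
  linarith

end Spectral

/-! ### The Schrödinger operator, its form and its variational principle -/

section Operators

open scoped ComplexConjugate

variable {d : ℕ}

theorem coeFn_mulOp (w : EuclideanSpace ℝ (Fin d) → ℂ) (f : (mulOp w).domain) :
    mulOp w f =ᵐ[volume] fun x => w x * (f : L2 d) x :=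
  MemLp.coeFn_toLp (show MemLp (fun x => w x * (f : L2 d) x) 2 volume from f.2)

theorem inner_mulOp_left (w : EuclideanSpace ℝ (Fin d) → ℝ)
    (f g : (mulOp fun x => (w x : ℂ)).domain) :
    inner ℂ (mulOp (fun x => (w x : ℂ)) f) (g : L2 d)
      = inner ℂ (f : L2 d) (mulOp (fun x => (w x : ℂ)) g) := by
  rw [L2.inner_def, L2.inner_def]
  refine integral_congr_ae ?_
  filter_upwards [coeFn_mulOp _ f, coeFn_mulOp _ g] with x hf hg
  rw [hf, hg, RCLike.inner_apply, RCLike.inner_apply, map_mul, Complex.conj_ofReal]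
  ring

theorem inner_fourierInv_left (f g : L2 d) :
    inner ℂ (𝓕⁻ f) g = inner ℂ f (𝓕 g) := by
  rw [← Lp.inner_fourier_eq, FourierTransform.fourier_fourierInv_eq]

theorem inner_fourierInv_right (f g : L2 d) :
    inner ℂ f (𝓕⁻ g) = inner ℂ (𝓕 f) g := by
  rw [← Lp.inner_fourier_eq, FourierTransform.fourier_fourierInv_eq]

theorem fourierMultiplier_apply (w : EuclideanSpace ℝ (Fin d) → ℂ)
    (f : (fourierMultiplier w).domain) :
    fourierMultiplier w f = 𝓕⁻ (mulOp w ⟨𝓕 (f : L2 d), f.2⟩) := rfl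

theorem inner_fourierMultiplier_left (w : EuclideanSpace ℝ (Fin d) → ℝ)
    (f g : (fourierMultiplier fun x => (w x : ℂ)).domain) :
    inner ℂ (fourierMultiplier (fun x => (w x : ℂ)) f) (g : L2 d)
      = inner ℂ (f : L2 d) (fourierMultiplier (fun x => (w x : ℂ)) g) := by
  rw [fourierMultiplier_apply, fourierMultiplier_apply, inner_fourierInv_left,
    inner_fourierInv_right]
  exact inner_mulOp_left w ⟨𝓕 (f : L2 d), f.2⟩ ⟨𝓕 (g : L2 d), g.2⟩

theorem schrodingerOp_apply {m α v : ℝ} {K : Set (EuclideanSpace ℝ (Fin d))} (f : L2 d)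
    (h : f ∈ (schrodingerOp m α v K).domain) (h1 : f ∈ (relOp d m α).domain)
    (h2 : f ∈ (mulOp (well v K)).domain) :
    schrodingerOp m α v K ⟨f, h⟩ = relOp d m α ⟨f, h1⟩ + mulOp (well v K) ⟨f, h2⟩ :=
  LinearPMap.add_apply _ _ _

theorem mem_schrodingerOp_domain {m α v : ℝ} {K : Set (EuclideanSpace ℝ (Fin d))} {f : L2 d} :
    f ∈ (schrodingerOp m α v K).domain ↔
      f ∈ (relOp d m α).domain ∧ f ∈ (mulOp (well v K)).domain := Iff.rfl

open Classical in
theorem well_eq_ofReal (v : ℝ) (K : Set (EuclideanSpace ℝ (Fin d))) :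
    well v K = fun x => (((if x ∈ K then -v else 0 : ℝ)) : ℂ) := by
  funext x
  unfold well
  split_ifs <;> simp

theorem inner_mulOp_well_left (v : ℝ) (K : Set (EuclideanSpace ℝ (Fin d)))
    (f g : (mulOp (well v K)).domain) :
    inner ℂ (mulOp (well v K) f) (g : L2 d) = inner ℂ (f : L2 d) (mulOp (well v K) g) := by
  classical
  have h := inner_mulOp_left (d := d) (fun x => if x ∈ K then -v else 0)
  rw [← well_eq_ofReal] at h
  exact h f g

theorem inner_schrodingerOp_left (m α v : ℝ) (K : Set (EuclideanSpace ℝ (Fin d)))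
    (f g : (schrodingerOp m α v K).domain) :
    inner ℂ (schrodingerOp m α v K f) (g : L2 d)
      = inner ℂ (f : L2 d) (schrodingerOp m α v K g) := by
  obtain ⟨f, hf⟩ := f
  obtain ⟨g, hg⟩ := g
  have hf' := mem_schrodingerOp_domain.1 hf
  have hg' := mem_schrodingerOp_domain.1 hg
  rw [schrodingerOp_apply f hf hf'.1 hf'.2, schrodingerOp_apply g hg hg'.1 hg'.2,
    inner_add_left, inner_add_right]
  exact congrArg₂ (· + ·) (inner_fourierMultiplier_left _ ⟨f, hf'.1⟩ ⟨g, hg'.1⟩)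
    (inner_mulOp_well_left v K ⟨f, hf'.2⟩ ⟨g, hg'.2⟩)

theorem memLp_top_well (v : ℝ) {K : Set (EuclideanSpace ℝ (Fin d))}
    (hK : NullMeasurableSet K volume) : MemLp (well v K) ⊤ := by
  refine memLp_top_of_bound ?_ |v| (Filter.Eventually.of_forall fun x => ?_)
  · have : well v K = K.indicator fun _ => -(v : ℂ) := by
      funext x
      by_cases hx : x ∈ K <;> simp [well, hx]
    rw [this]
    exact (aestronglyMeasurable_const.indicator₀ hK)
  · unfold well
    split_ifs <;> simp

theorem mem_mulDomain_of_memLp_top {w : EuclideanSpace ℝ (Fin d) → ℂ} (hw : MemLp w ⊤)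
    (f : L2 d) : f ∈ mulDomain w :=
  (Lp.memLp (bddMul hw f)).ae_eq (coeFn_bddMul hw f)

theorem mulOp_eq_bddMul {w : EuclideanSpace ℝ (Fin d) → ℂ} (hw : MemLp w ⊤)
    (f : (mulOp w).domain) : mulOp w f = bddMul hw f :=
  Lp.ext ((coeFn_mulOp w f).trans (coeFn_bddMul hw f).symm)

/-- Plancherel. Adding `m ‖f‖²` cancels the `-m` in `Phi`, and the nonnegative symbol that remains
lets the real integral be read in `[0, ∞]`. -/
theorem energy_eq_ofReal_inner_relOp {m α : ℝ} (hm : 0 ≤ m) (f : (relOp d m α).domain) :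
    energy (m ^ (2 / α)) (α / 2) (f : L2 d)
      = ENNReal.ofReal ((inner ℂ (relOp d m α f) (f : L2 d)).re + m * ‖(f : L2 d)‖ ^ 2) := by
  set w : L2 d := 𝓕 (f : L2 d) with hw
  let σ : EuclideanSpace ℝ (Fin d) → ℝ := fun ξ => Phi m α ((2 * Real.pi * ‖ξ‖) ^ 2)
  have hdom : MemLp (fun ξ => (σ ξ : ℂ) * w ξ) 2 volume := f.2
  have hI : Integrable fun ξ => ((σ ξ : ℂ) * w ξ) * conj (w ξ) :=
    MemLp.integrable_mul (p := 2) (q := 2) hdom (Lp.memLp w).star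
  have heq : ∀ ξ, (((σ ξ : ℂ) * w ξ) * conj (w ξ)).re = σ ξ * ‖w ξ‖ ^ 2 := by
    intro ξ
    rw [mul_assoc, Complex.mul_conj, Complex.normSq_eq_norm_sq, ← Complex.ofReal_mul,
      Complex.ofReal_re]
  have hI' : Integrable fun ξ => σ ξ * ‖w ξ‖ ^ 2 :=
    hI.re.congr (Filter.Eventually.of_forall heq)
  have hinner : (inner ℂ (relOp d m α f) (f : L2 d)).re = ∫ ξ, σ ξ * ‖w ξ‖ ^ 2 := by
    change (inner ℂ (𝓕⁻ (mulOp (fun ξ => (σ ξ : ℂ)) ⟨w, f.2⟩)) (f : L2 d)).re = _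
    rw [inner_fourierInv_left, ← inner_conj_symm, Complex.conj_re, L2.inner_def]
    have h : (∫ ξ, inner ℂ (w ξ) (mulOp (fun ξ => (σ ξ : ℂ)) ⟨w, f.2⟩ ξ))
        = ∫ ξ, ((σ ξ : ℂ) * w ξ) * conj (w ξ) := by
      refine integral_congr_ae ?_
      filter_upwards [coeFn_mulOp (fun ξ => (σ ξ : ℂ)) ⟨w, f.2⟩] with ξ hξ
      rw [hξ, RCLike.inner_apply]
    rw [← hw, h]
    exact (integral_re hI).symm.trans (integral_congr_ae (Filter.Eventually.of_forall heq))
  have hnorm : m * ‖(f : L2 d)‖ ^ 2 = ∫ ξ, m * ‖w ξ‖ ^ 2 := by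
    rw [integral_const_mul, integral_norm_sq, hw, Lp.norm_fourier_eq]
  have hM : 0 ≤ m ^ (2 / α) := Real.rpow_nonneg hm _
  rw [hinner, hnorm, ← integral_add' hI' ((integrable_norm_sq w).const_mul m),
    ofReal_integral_eq_lintegral_ofReal (hI'.add ((integrable_norm_sq w).const_mul m)), energy]
  · refine lintegral_congr fun ξ => ?_
    rw [← ENNReal.ofReal_mul (by positivity)]
    simp only [Pi.add_apply, ← add_mul, σ, Phi, sub_add_cancel, ← hw]
  · refine Filter.Eventually.of_forall fun ξ => ?_
    simp only [σ, Phi, Pi.zero_apply, Pi.add_apply]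
    rw [← add_mul, sub_add_cancel]
    positivity

/-- The form `l ‖u‖² + v ∫_K |u|²` against which the kinetic energy is compared. -/
def potentialForm (l v : ℝ) {K : Set (EuclideanSpace ℝ (Fin d))}
    (hK : NullMeasurableSet K volume) (u : L2 d) : ℝ :=
  l * ‖u‖ ^ 2 - (inner ℂ u (bddMul (memLp_top_well v hK) u)).re

theorem continuous_potentialForm (l v : ℝ) {K : Set (EuclideanSpace ℝ (Fin d))}
    (hK : NullMeasurableSet K volume) : Continuous (potentialForm l v hK) := by
  have h : Continuous fun u : L2 d => inner ℂ u (bddMul (memLp_top_well v hK) u) :=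
    continuous_id.inner (bddMul _).continuous
  exact ((continuous_norm.pow 2).const_mul l).sub (Complex.continuous_re.comp h)

theorem potentialForm_absLp (l v : ℝ) {K : Set (EuclideanSpace ℝ (Fin d))}
    (hK : NullMeasurableSet K volume) (u : L2 d) :
    potentialForm l v hK (absLp u) = potentialForm l v hK u := by
  unfold potentialForm
  rw [norm_absLp, inner_bddMul, inner_bddMul]
  congr 2
  refine integral_congr_ae ?_
  filter_upwards [coeFn_absLp u] with x hx
  rw [hx, Complex.mul_conj, Complex.mul_conj, Complex.normSq_ofReal,
    Complex.normSq_eq_norm_sq, pow_two]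

theorem inner_schrodingerOp_self {m α : ℝ} (v : ℝ) {K : Set (EuclideanSpace ℝ (Fin d))}
    (hK : NullMeasurableSet K volume) {f : L2 d} (hf : f ∈ (schrodingerOp m α v K).domain)
    (hf' : f ∈ (relOp d m α).domain) :
    (inner ℂ (schrodingerOp m α v K ⟨f, hf⟩) f).re
      = (inner ℂ (relOp d m α ⟨f, hf'⟩) f).re
        + (inner ℂ f (bddMul (memLp_top_well v hK) f)).re := by
  rw [schrodingerOp_apply f hf hf' (mem_schrodingerOp_domain.1 hf).2, inner_add_left,
    Complex.add_re, mulOp_eq_bddMul (memLp_top_well v hK),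
    ← inner_conj_symm _ (bddMul (memLp_top_well v hK) f), Complex.conj_re]

theorem energy_eq_ofReal_inner_schrodingerOp {m α : ℝ} (hm : 0 ≤ m) (v : ℝ)
    {K : Set (EuclideanSpace ℝ (Fin d))} (hK : NullMeasurableSet K volume)
    (f : (schrodingerOp m α v K).domain) :
    energy (m ^ (2 / α)) (α / 2) (f : L2 d)
      = ENNReal.ofReal ((inner ℂ (schrodingerOp m α v K f) (f : L2 d)).re
        + potentialForm m v hK f) := by
  obtain ⟨f, hf⟩ := f
  have hf' := (mem_schrodingerOp_domain.1 hf).1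
  rw [inner_schrodingerOp_self v hK hf hf', potentialForm]
  refine (energy_eq_ofReal_inner_relOp hm ⟨f, hf'⟩).trans ?_
  congr 1
  ring

/-! ### Frequency truncation and the bound on all of `L²` -/

theorem memLp_top_indicator_closedBall (n : ℕ) :
    MemLp ((Metric.closedBall (0 : EuclideanSpace ℝ (Fin d)) n).indicator fun _ => (1 : ℂ)) ⊤ :=
  (memLp_top_const 1).indicator measurableSet_closedBall

/-- Restriction of the Fourier transform to the ball of radius `n`. -/
def lowPass (n : ℕ) (u : L2 d) : L2 d :=
  𝓕⁻ (bddMul (memLp_top_indicator_closedBall n) (𝓕 u))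

theorem coeFn_fourier_lowPass (n : ℕ) (u : L2 d) :
    (𝓕 (lowPass n u) : L2 d) =ᵐ[volume]
      (Metric.closedBall (0 : EuclideanSpace ℝ (Fin d)) n).indicator (𝓕 u : L2 d) := by
  rw [lowPass, FourierTransform.fourier_fourierInv_eq]
  filter_upwards [coeFn_bddMul (memLp_top_indicator_closedBall n) (𝓕 u : L2 d)] with ξ hξ
  rw [hξ]
  by_cases h : ξ ∈ Metric.closedBall (0 : EuclideanSpace ℝ (Fin d)) n
  · rw [Set.indicator_of_mem h, Set.indicator_of_mem h, one_mul]
  · rw [Set.indicator_of_notMem h, Set.indicator_of_notMem h, zero_mul]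

theorem energy_lowPass_le (M a : ℝ) (n : ℕ) (u : L2 d) :
    energy M a (lowPass n u) ≤ energy M a u := by
  refine lintegral_mono_ae ?_
  filter_upwards [coeFn_fourier_lowPass n u] with ξ hξ
  rw [hξ]
  gcongr
  exact norm_indicator_le_norm_self _ _

theorem tendsto_lowPass (u : L2 d) :
    Filter.Tendsto (fun n => lowPass n u) Filter.atTop (nhds u) := by
  rw [tendsto_iff_norm_sub_tendsto_zero]
  set w : L2 d := 𝓕 u with hw
  have hsq : ∀ n, ‖lowPass n u - u‖ ^ 2
      = ∫ ξ, ‖(Metric.closedBall (0 : EuclideanSpace ℝ (Fin d)) n)ᶜ.indicator w ξ‖ ^ 2 := by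
    intro n
    rw [← Lp.norm_fourier_eq, show (𝓕 (lowPass n u - u) : L2 d) = 𝓕 (lowPass n u) - 𝓕 u from
      (Lp.fourierTransformₗᵢ _ _).map_sub _ _, ← integral_norm_sq]
    refine integral_congr_ae ?_
    filter_upwards [coeFn_fourier_lowPass n u, Lp.coeFn_sub (𝓕 (lowPass n u) : L2 d) (𝓕 u)]
      with ξ h1 h2
    rw [h2, Pi.sub_apply, h1]
    by_cases h : ξ ∈ Metric.closedBall (0 : EuclideanSpace ℝ (Fin d)) n
    · rw [Set.indicator_of_mem h, Set.indicator_of_notMem (not_not.2 h), sub_self]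
    · rw [Set.indicator_of_notMem h, Set.indicator_of_mem h, zero_sub, norm_neg]
  have hlim : Filter.Tendsto (fun n => ‖lowPass n u - u‖ ^ 2) Filter.atTop (nhds 0) := by
    simp_rw [hsq]
    have h0 : ∫ _ : EuclideanSpace ℝ (Fin d), (0 : ℝ) = 0 := integral_zero _ _
    rw [← h0]
    refine tendsto_integral_of_dominated_convergence (fun ξ => ‖w ξ‖ ^ 2) (fun n => ?_)
      (integrable_norm_sq w) (fun n => ?_) ?_
    · exact (((Lp.aestronglyMeasurable w).indicator
        measurableSet_closedBall.compl).norm.pow 2)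
    · refine Filter.Eventually.of_forall fun ξ => ?_
      rw [Real.norm_of_nonneg (by positivity)]
      gcongr
      exact norm_indicator_le_norm_self _ _
    · refine Filter.Eventually.of_forall fun ξ => ?_
      refine tendsto_const_nhds.congr' ?_
      obtain ⟨N, hN⟩ := exists_nat_ge ‖ξ‖
      filter_upwards [Filter.eventually_ge_atTop N] with n hn
      have : ξ ∈ Metric.closedBall (0 : EuclideanSpace ℝ (Fin d)) n := by
        rw [mem_closedBall_zero_iff]
        exact hN.trans (by exact_mod_cast hn)
      simp [this]
  have := hlim.sqrt
  simpa [Real.sqrt_sq (norm_nonneg _)] using this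

theorem continuous_Phi {m α : ℝ} (hα : 0 < α) :
    Continuous fun ξ : EuclideanSpace ℝ (Fin d) => Phi m α ((2 * Real.pi * ‖ξ‖) ^ 2) := by
  unfold Phi
  refine Continuous.sub (Continuous.rpow_const (by fun_prop) fun ξ => Or.inr ?_) continuous_const
  positivity

/-- The symbol is continuous, hence bounded on the ball that carries the truncated transform, and
the well is bounded. -/
theorem lowPass_mem_domain {m α : ℝ} (hα : 0 < α) (v : ℝ)
    {K : Set (EuclideanSpace ℝ (Fin d))} (hK : NullMeasurableSet K volume) (n : ℕ) (u : L2 d) :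
    lowPass n u ∈ (schrodingerOp m α v K).domain := by
  refine ⟨?_, mem_mulDomain_of_memLp_top (memLp_top_well v hK) _⟩
  set B := Metric.closedBall (0 : EuclideanSpace ℝ (Fin d)) n
  let σ : EuclideanSpace ℝ (Fin d) → ℂ := fun ξ => (Phi m α ((2 * Real.pi * ‖ξ‖) ^ 2) : ℝ)
  have hσ : Continuous σ := Complex.continuous_ofReal.comp (continuous_Phi hα)
  obtain ⟨C, hC⟩ := (isCompact_closedBall (0 : EuclideanSpace ℝ (Fin d)) n).exists_bound_of_continuousOn
    hσ.continuousOn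
  have hbdd : MemLp (B.indicator σ) ⊤ := by
    refine memLp_top_of_bound (hσ.aestronglyMeasurable.indicator measurableSet_closedBall)
      (max C 0) (Filter.Eventually.of_forall fun ξ => ?_)
    by_cases hξ : ξ ∈ B
    · rw [Set.indicator_of_mem hξ]
      exact (hC ξ hξ).trans (le_max_left _ _)
    · rw [Set.indicator_of_notMem hξ, norm_zero]
      exact le_max_right _ _
  change MemLp (fun ξ => σ ξ * (𝓕 (lowPass n u) : L2 d) ξ) 2 volume
  refine (Lp.memLp (bddMul hbdd (𝓕 u))).ae_eq ?_
  filter_upwards [coeFn_bddMul hbdd (𝓕 u : L2 d), coeFn_fourier_lowPass n u] with ξ h1 h2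
  rw [h1, h2]
  by_cases h : ξ ∈ B
  · rw [Set.indicator_of_mem h, Set.indicator_of_mem h]
  · rw [Set.indicator_of_notMem h, Set.indicator_of_notMem h, zero_mul, mul_zero]

/-- The variational characterisation of the bottom of the spectrum on the form domain. -/
theorem ofReal_potentialForm_le_energy {m α v l : ℝ} (hm : 0 ≤ m) (hα : 0 < α)
    {K : Set (EuclideanSpace ℝ (Fin d))} (hK : NullMeasurableSet K volume)
    (hl : ∀ r : ℝ, r < l → (r : ℂ) ∈ resolventSet (schrodingerOp m α v K)) (u : L2 d) :
    ENNReal.ofReal (potentialForm (m + l) v hK u) ≤ energy (m ^ (2 / α)) (α / 2) u := by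
  -- The form bound applies to the truncations of `u`. In the limit the left side is continuous,
  -- while the truncated energies never exceed that of `u`.
  have htends := ((ENNReal.continuous_ofReal.comp
    (continuous_potentialForm (m + l) v hK)).tendsto u).comp (tendsto_lowPass u)
  refine le_of_tendsto' htends fun n => ?_
  refine le_trans ?_ (energy_lowPass_le _ _ n u)
  have hdom := lowPass_mem_domain (m := m) hα v hK n u
  rw [energy_eq_ofReal_inner_schrodingerOp hm v hK ⟨_, hdom⟩]
  refine ENNReal.ofReal_le_ofReal ?_
  have h := le_re_inner_of_lt_mem_resolventSet (inner_schrodingerOp_left m α v K) hl ⟨_, hdom⟩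
  simp only [potentialForm] at h ⊢
  linarith

/-- Equality case of `ofReal_potentialForm_le_energy`: pair the eigenvalue equation with `u`. -/
theorem energy_eq_of_eigenvector {m α v l : ℝ} (hm : 0 ≤ m)
    {K : Set (EuclideanSpace ℝ (Fin d))} (hK : NullMeasurableSet K volume)
    (u : (schrodingerOp m α v K).domain) (hu : schrodingerOp m α v K u = (l : ℂ) • (u : L2 d)) :
    energy (m ^ (2 / α)) (α / 2) (u : L2 d)
      = ENNReal.ofReal (potentialForm (m + l) v hK u) := by
  rw [energy_eq_ofReal_inner_schrodingerOp hm v hK, hu, inner_smul_left, Complex.conj_ofReal,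
    inner_self_eq_norm_sq_to_K]
  congr 1
  have : (((l : ℂ) * ((‖(u : L2 d)‖ : ℂ)) ^ 2)).re = l * ‖(u : L2 d)‖ ^ 2 := by
    rw [← Complex.ofReal_pow, ← Complex.ofReal_mul, Complex.ofReal_re]
  simp only [potentialForm]
  erw [this]
  ring

/-- Eigenfunctions at the bottom of the spectrum have constant phase. -/
theorem exists_phase_of_eigenvector {m α v l : ℝ} (hm : 0 ≤ m) (hα0 : 0 < α) (hα2 : α < 2)
    {K : Set (EuclideanSpace ℝ (Fin d))} (hK : NullMeasurableSet K volume)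
    (hl : ∀ r : ℝ, r < l → (r : ℂ) ∈ resolventSet (schrodingerOp m α v K))
    (u : (schrodingerOp m α v K).domain) (hu : schrodingerOp m α v K u = (l : ℂ) • (u : L2 d)) :
    ∃ c : ℂ, ∀ᵐ x, (u : L2 d) x = c * ‖(u : L2 d) x‖ := by
  have h := energy_eq_of_eigenvector hm hK u hu
  refine exists_phase_of_energy_le (M := m ^ (2 / α)) (a := α / 2) (Real.rpow_nonneg hm _)
    (by linarith) (by linarith) ?_ ?_
  · rw [h]
    exact ENNReal.ofReal_ne_top
  -- The energy of `u` equals its potential form, which is that of `|u|`, which is at most the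
  -- energy of `|u|`.
  · rw [h, ← potentialForm_absLp]
    exact ofReal_potentialForm_le_energy hm hα0 hK hl _

end Operators

/-! ### Invariance under isometries that preserve the well -/

section Symmetry

variable {d : ℕ}

/-- Composition with a linear isometry, as an isometry of `L²`. -/
def compIsometry (S : EuclideanSpace ℝ (Fin d) ≃ₗᵢ[ℝ] EuclideanSpace ℝ (Fin d)) :
    L2 d →ₗᵢ[ℂ] L2 d :=
  Lp.compMeasurePreservingₗᵢ ℂ S S.measurePreserving

variable (S : EuclideanSpace ℝ (Fin d) ≃ₗᵢ[ℝ] EuclideanSpace ℝ (Fin d))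

theorem coeFn_compIsometry (f : L2 d) :
    compIsometry S f =ᵐ[volume] fun x => f (S x) :=
  Lp.coeFn_compMeasurePreserving f S.measurePreserving

theorem ae_comp_isometry {p : EuclideanSpace ℝ (Fin d) → Prop} (h : ∀ᵐ x, p x) :
    ∀ᵐ x, p (S x) :=
  S.measurePreserving.quasiMeasurePreserving.ae h

/-- A change of variables on Schwartz functions, extended by density since both sides are
continuous. -/
theorem fourier_compIsometry (f : L2 d) : 𝓕 (compIsometry S f) = compIsometry S (𝓕 f) := by
  refine DenseRange.induction_on
    (p := fun f : L2 d => 𝓕 (compIsometry S f) = compIsometry S (𝓕 f))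
    (SchwartzMap.denseRange_toLpCLM (E := EuclideanSpace ℝ (Fin d)) (F := ℂ) (p := 2)
      (μ := volume) ENNReal.ofNat_ne_top) f ?_ ?_
  · have h : Continuous fun u : L2 d => 𝓕 u := FourierTransform.continuous_fourier
    exact isClosed_eq (h.comp (compIsometry S).continuous) ((compIsometry S).continuous.comp h)
  · intro g
    let gS : SchwartzMap (EuclideanSpace ℝ (Fin d)) ℂ :=
      SchwartzMap.compCLMOfContinuousLinearEquiv ℂ S.toContinuousLinearEquiv g
    have hgS : ∀ x, gS x = g (S x) := fun x => rfl
    have h1 : compIsometry S (g.toLp 2 volume) = gS.toLp 2 volume := by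
      refine Lp.ext ?_
      filter_upwards [coeFn_compIsometry S (g.toLp 2 volume), gS.coeFn_toLp 2 volume,
        ae_comp_isometry S (g.coeFn_toLp 2 volume)] with x h1 h2 h3
      rw [h1, h2, h3, hgS]
    have hg : (SchwartzMap.toLpCLM ℝ ℂ 2 (volume : Measure (EuclideanSpace ℝ (Fin d)))) g
      = g.toLp 2 volume := rfl
    rw [hg, h1, SchwartzMap.toLp_fourier_eq, SchwartzMap.toLp_fourier_eq]
    refine Lp.ext ?_
    filter_upwards [coeFn_compIsometry S ((𝓕 g).toLp 2 volume), (𝓕 gS).coeFn_toLp 2 volume,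
        ae_comp_isometry S ((𝓕 g).coeFn_toLp 2 volume)] with x h1 h2 h3
    rw [h1, h2, h3, SchwartzMap.fourier_coe, SchwartzMap.fourier_coe]
    exact Real.fourier_comp_linearIsometry S g x

theorem fourierInv_compIsometry (f : L2 d) : 𝓕⁻ (compIsometry S f) = compIsometry S (𝓕⁻ f) := by
  have h := fourier_compIsometry S (𝓕⁻ f)
  rw [FourierTransform.fourier_fourierInv_eq] at h
  rw [← h, FourierTransform.fourierInv_fourier_eq]

variable {S}

theorem compIsometry_mem_mulDomain {w : EuclideanSpace ℝ (Fin d) → ℂ} (hw : ∀ x, w (S x) = w x)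
    {f : L2 d} (hf : f ∈ mulDomain w) : compIsometry S f ∈ mulDomain w := by
  have h : MemLp (fun x => w x * f x) 2 volume := hf
  refine (h.comp_measurePreserving S.measurePreserving).ae_eq ?_
  filter_upwards [coeFn_compIsometry S f] with x hx
  rw [hx, Function.comp_apply, hw]

theorem mulOp_compIsometry {w : EuclideanSpace ℝ (Fin d) → ℂ} (hw : ∀ x, w (S x) = w x)
    (f : (mulOp w).domain) :
    mulOp w ⟨compIsometry S f, compIsometry_mem_mulDomain hw f.2⟩
      = compIsometry S (mulOp w f) := by
  refine Lp.ext ?_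
  filter_upwards [coeFn_mulOp w ⟨compIsometry S f, compIsometry_mem_mulDomain hw f.2⟩,
    coeFn_compIsometry S (mulOp w f), coeFn_compIsometry S (f : L2 d),
    ae_comp_isometry S (coeFn_mulOp w f)] with x h1 h2 h3 h4
  rw [h1, h2, h3, h4, hw]

theorem compIsometry_mem_fourierMultiplier_domain {w : EuclideanSpace ℝ (Fin d) → ℂ}
    (hw : ∀ x, w (S x) = w x) {f : L2 d} (hf : f ∈ (fourierMultiplier w).domain) :
    compIsometry S f ∈ (fourierMultiplier w).domain := by
  change (𝓕 (compIsometry S f) : L2 d) ∈ mulDomain w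
  rw [fourier_compIsometry]
  exact compIsometry_mem_mulDomain hw hf

theorem fourierMultiplier_compIsometry {w : EuclideanSpace ℝ (Fin d) → ℂ}
    (hw : ∀ x, w (S x) = w x) (f : (fourierMultiplier w).domain) :
    fourierMultiplier w ⟨compIsometry S f, compIsometry_mem_fourierMultiplier_domain hw f.2⟩
      = compIsometry S (fourierMultiplier w f) := by
  change 𝓕⁻ (mulOp w ⟨𝓕 (compIsometry S (f : L2 d)), _⟩)
    = compIsometry S (𝓕⁻ (mulOp w ⟨𝓕 (f : L2 d), f.2⟩))
  rw [← fourierInv_compIsometry, ← mulOp_compIsometry hw]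
  congr 3
  exact fourier_compIsometry S f

theorem Phi_comp_isometry (m α : ℝ) (x : EuclideanSpace ℝ (Fin d)) :
    ((Phi m α ((2 * Real.pi * ‖S x‖) ^ 2) : ℝ) : ℂ) = (Phi m α ((2 * Real.pi * ‖x‖) ^ 2) : ℝ) := by
  rw [S.norm_map]

theorem well_comp_isometry (v : ℝ) {K : Set (EuclideanSpace ℝ (Fin d))} (hK : S '' K = K)
    (x : EuclideanSpace ℝ (Fin d)) : well v K (S x) = well v K x := by
  have : S x ∈ K ↔ x ∈ K := by
    conv_lhs => rw [← hK]
    exact S.injective.mem_set_image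
  by_cases h : x ∈ K <;> simp [well, this, h]

theorem compIsometry_mem_domain {m α v : ℝ} {K : Set (EuclideanSpace ℝ (Fin d))}
    (hK : S '' K = K) {f : L2 d} (hf : f ∈ (schrodingerOp m α v K).domain) :
    compIsometry S f ∈ (schrodingerOp m α v K).domain :=
  ⟨compIsometry_mem_fourierMultiplier_domain (Phi_comp_isometry m α) hf.1,
    compIsometry_mem_mulDomain (well_comp_isometry v hK) hf.2⟩

theorem schrodingerOp_compIsometry {m α v : ℝ} {K : Set (EuclideanSpace ℝ (Fin d))}
    (hK : S '' K = K) (f : (schrodingerOp m α v K).domain) :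
    schrodingerOp m α v K ⟨compIsometry S f, compIsometry_mem_domain hK f.2⟩
      = compIsometry S (schrodingerOp m α v K f) := by
  obtain ⟨f, hf⟩ := f
  have hf' := mem_schrodingerOp_domain.1 hf
  have hSf' := mem_schrodingerOp_domain.1 (compIsometry_mem_domain hK hf)
  have h1 := fourierMultiplier_compIsometry (Phi_comp_isometry (S := S) m α) ⟨f, hf'.1⟩
  have h2 := mulOp_compIsometry (well_comp_isometry v hK) ⟨f, hf'.2⟩
  rw [schrodingerOp_apply f hf hf'.1 hf'.2, schrodingerOp_apply _ _ hSf'.1 hSf'.2, map_add]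
  exact congrArg₂ (· + ·) h1 h2

/-- An eigenfunction at the bottom of the spectrum is invariant under any isometric involution
that preserves the well. -/
theorem compIsometry_eq_self_of_eigenvector {m α v l : ℝ} (hm : 0 ≤ m) (hα0 : 0 < α) (hα2 : α < 2)
    {K : Set (EuclideanSpace ℝ (Fin d))} (hK : NullMeasurableSet K volume)
    (hl : ∀ r : ℝ, r < l → (r : ℂ) ∈ resolventSet (schrodingerOp m α v K))
    (hS : ∀ x, S (S x) = x) (hSK : S '' K = K)
    (f : (schrodingerOp m α v K).domain) (hf : schrodingerOp m α v K f = (l : ℂ) • (f : L2 d)) :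
    compIsometry S (f : L2 d) = f := by
  let g : (schrodingerOp m α v K).domain :=
    ⟨compIsometry S (f : L2 d), compIsometry_mem_domain hSK f.2⟩
  have hg : schrodingerOp m α v K g = (l : ℂ) • (g : L2 d) := by
    rw [schrodingerOp_compIsometry hSK, hf, map_smul]
  have hfg : schrodingerOp m α v K (f - g) = (l : ℂ) • ((f - g : _) : L2 d) := by
    rw [LinearPMap.map_sub, hf, hg, ← smul_sub]
    rfl
  obtain ⟨c, hc⟩ := exists_phase_of_eigenvector hm hα0 hα2 hK hl (f - g) hfg
  have hu : ∀ᵐ x, ((f - g : _) : L2 d) x = (f : L2 d) x - (f : L2 d) (S x) := by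
    filter_upwards [Lp.coeFn_sub (f : L2 d) (g : L2 d), coeFn_compIsometry S (f : L2 d)]
      with x h1 h2
    rw [Submodule.coe_sub, h1, Pi.sub_apply]
    exact congrArg _ h2
  refine Lp.ext ?_
  filter_upwards [coeFn_compIsometry S (f : L2 d), hc, ae_comp_isometry S hc, hu,
    ae_comp_isometry S hu] with x h1 h2 h3 h4 h5
  rw [hS] at h5
  have h6 : ((f - g : _) : L2 d) (S x) = -((f - g : _) : L2 d) x := by
    rw [h5, h4]; ring
  -- Oddness gives `u (S x) = -u x`, while constant phase gives `u (S x) = c * ‖u (S x)‖ = c * ‖u x‖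
  -- = u x`.
  rw [h6, norm_neg, ← h2] at h3
  have h7 : ((f - g : _) : L2 d) x = 0 := self_eq_neg.1 h3.symm
  rw [h1]
  rw [h4] at h7
  exact (sub_eq_zero.1 h7).symm

end Symmetry

end RelSchrodinger

end

theorem theorem4p4 (d : ℕ) (α m v : ℝ) (hα0 : 0 < α) (hα2 : α < 2) (hm : 0 ≤ m) (hv : 0 < v)
    (K : Set (EuclideanSpace ℝ (Fin d))) (hKmeas : NullMeasurableSet K MeasureTheory.volume)
    (hKbdd : Bornology.IsBounded K) (hKint : (interior K).Nonempty)
    (P : Submodule ℝ (EuclideanSpace ℝ (Fin d))) (hP : Module.finrank ℝ P + 1 = d)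
    (hK : P.reflection '' K = K)
    (f : RelSchrodinger.L2 d)
    (hf : RelSchrodinger.IsGroundState (RelSchrodinger.schrodingerOp m α v K) f) :
    (∀ᵐ x, f (P.reflection x) = f x) ∧
      ∀ φ : EuclideanSpace ℝ (Fin d) → ℂ, Continuous φ → f =ᵐ[MeasureTheory.volume] φ →
        ∀ x, φ (P.reflection x) = φ x := by
  obtain ⟨-, l, hl, hdom, heig⟩ := hf
  have hres : ∀ r : ℝ, r < l →
      (r : ℂ) ∈ RelSchrodinger.resolventSet (RelSchrodinger.schrodingerOp m α v K) := by
    intro r hr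
    by_contra h
    exact hr.not_ge (hl.1 h)
  have hinv := RelSchrodinger.compIsometry_eq_self_of_eigenvector hm hα0 hα2 hKmeas hres
    P.reflection_reflection hK ⟨f, hdom⟩ heig
  have hae : ∀ᵐ x, f (P.reflection x) = f x := by
    filter_upwards [RelSchrodinger.coeFn_compIsometry P.reflection f] with x hx
    rw [← hx]
    exact congrArg (fun g : RelSchrodinger.L2 d => g x) hinv
  refine ⟨hae, fun φ hφ hfφ => ?_⟩
  have h : (fun x => φ (P.reflection x)) =ᵐ[volume] φ := by
    filter_upwards [hae, hfφ, RelSchrodinger.ae_comp_isometry P.reflection hfφ] with x h1 h2 h3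
    rw [← h3, h1, h2]
  -- Lebesgue measure charges every nonempty open set, so continuous functions equal almost
  -- everywhere are equal.
  exact congrFun (((hφ.comp P.reflection.continuous).ae_eq_iff_eq volume hφ).1 h)
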